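/- Let $T[1..n]$ be a nonempty string over any alphabet. A *parse* of $T$ is a partition of $T$ into nonempty consecutive phrases $T[t..t+\ell-1]$, each of which is either an explicit symbol (then $\ell=1$) or is copied from a source $T[s..s+\ell-1]=T[t..t+\ell-1]$ with $s\ne t$ (the position $t+j$ is copied from $s+j$ for $0\le j<\ell$). It is a *valid bidirectional scheme* if the map sending each copied position to the position it is copied from has no cycles; $b$ is the least number of phrases of a valid bidirectional scheme for $T$. Given a total order $\preceq$ on the suffixes of $T$, with strict part $\prec$, a parse is *ordered* if $T[s+j..]\prec T[t+j..]$ holds for every copied phrase and all $0\le j<\ell$. An ordered parse is *ordered-optimal* if no ordered parse of $T$ with respect to the same order has fewer phrases; here sources may overlap their targets, and in the *non-overlapping* version only the parses in which every copied phrase is disjoint from its source are considered. The order is *extensible* if $T[s..]\prec T[t..]$, $T[s]=T[t]$ and $s,t<n$ imply $T[s+1..]\prec T[t+1..]$. A straight-line program (SLP) is a sequence of rules $A\to a$ ($a$ a terminal) and $A\to BC$ ($B,C$ nonterminals defined earlier in the sequence), one rule per nonterminal, which generates the expansion of its last nonterminal; a run-length SLP (RLSLP) may also use rules $A\to B^t$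 with an integer $t>0$ and $B$ defined earlier. Let $g$ and $g_{rl}$ be the least number of rules of an SLP and of an RLSLP, respectively, that generates $T$. **Theorem.** For any extensible order: 1. every ordered-optimal parse of $T$ that allows sources to overlap targets has $u\le g_{rl}+1$ phrases; 2. hence $u=O(b\log(n/b))$ for these parses: there is a universal constant $c$, independent of $T$, of its alphabet and of the order, such that $u\le c\,b\,\max(1,\log_2(n/b))$; 3. every ordered-optimal non-overlapping parse of $T$ has $u\le g+1$ phrases. -/

import Mathlib

/-! A text is a list `T` over an arbitrary alphabet `α`; its positions are numbered
`0, …, T.length - 1`. -/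

namespace TextParse

/-! ### Parses -/

/-- A phrase covers the `len` text positions `start, …, start + len - 1`. It is an explicit symbol
if `source = none`, and it is copied from the positions `s, …, s + len - 1`
if `source = some s`. -/
structure Phrase where
  start : ℕ
  len : ℕ
  source : Option ℕ

/-- The phrases `P`, listed from left to right, are consecutive and cover exactly the positions
`p, …, n - 1`. -/
def Tiles : ℕ → ℕ → List Phrase → Prop
  | p, n, [] => p = n
  | p, n, B :: P => B.start = p ∧ Tiles (p + B.len) n P

/-- An explicit phrase has length `1`; a copied phrase is nonempty, and its source is a different
substring of `T` with the same content (source and target may overlap). -/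
def Phrase.IsValid {α : Type*} (T : List α) (B : Phrase) : Prop :=
  match B.source with
  | none => B.len = 1
  | some s => 1 ≤ B.len ∧ s ≠ B.start ∧ s + B.len ≤ T.length ∧
      ∀ j < B.len, T[s + j]? = T[B.start + j]?

/-- `P` partitions `T` into phrases, each an explicit symbol or a copy of a substring of `T`. -/
def IsParse {α : Type*} (T : List α) (P : List Phrase) : Prop :=
  Tiles 0 T.length P ∧ ∀ B ∈ P, B.IsValid T

/-- The target-to-source map of the parse `P`, as a relation: position `p` lies in a copied
phrase, and it is copied from position `q`. -/
def CopiedFrom (P : List Phrase) (p q : ℕ) : Prop :=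
  ∃ B ∈ P, ∃ s, B.source = some s ∧ ∃ j < B.len, p = B.start + j ∧ q = s + j

/-- A valid bidirectional scheme: a parse whose target-to-source map has no cycles. -/
def IsBidirectionalScheme {α : Type*} (T : List α) (P : List Phrase) : Prop :=
  IsParse T P ∧ ∀ p, ¬ Relation.TransGen (CopiedFrom P) p p

/-- `b`: the least number of phrases of a valid bidirectional scheme for `T`. -/
noncomputable def bidirectionalSize {α : Type*} (T : List α) : ℕ :=
  sInf {k | ∃ P : List Phrase, IsBidirectionalScheme T P ∧ P.length = k}

/-! ### Ordered parses

A total order on the suffixes of `T` is given by its strict part `prec`, a relation on the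
starting positions of the suffixes: `prec s t` says that the suffix starting at `s` is strictly
smaller than the suffix starting at `t`. (Suffixes starting at distinct positions are distinct.) -/

/-- An ordered parse with respect to `prec`: every position inside a copied phrase is copied from
a position that starts a strictly smaller suffix. -/
def IsOrderedParse {α : Type*} (T : List α) (prec : Fin T.length → Fin T.length → Prop)
    (P : List Phrase) : Prop :=
  IsParse T P ∧ ∀ p q : Fin T.length, CopiedFrom P p q → prec q p

/-- No copied phrase of `P` overlaps its source. -/
def NonOverlapping (P : List Phrase) : Prop :=
  ∀ B ∈ P, ∀ s, B.source = some s → s + B.len ≤ B.start ∨ B.start + B.len ≤ s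

/-- `P` is an ordered-optimal parse of `T`, where sources may overlap targets. -/
def IsOrderedOptimal {α : Type*} (T : List α) (prec : Fin T.length → Fin T.length → Prop)
    (P : List Phrase) : Prop :=
  IsOrderedParse T prec P ∧ ∀ P', IsOrderedParse T prec P' → P.length ≤ P'.length

/-- `P` is an ordered-optimal parse of `T`, where sources must not overlap targets. -/
def IsOrderedOptimalNonOverlapping {α : Type*} (T : List α)
    (prec : Fin T.length → Fin T.length → Prop) (P : List Phrase) : Prop :=
  (IsOrderedParse T prec P ∧ NonOverlapping P) ∧
    ∀ P', IsOrderedParse T prec P' → NonOverlapping P' → P.length ≤ P'.length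

/-- The order is extensible: if the suffix at `s` is smaller than the suffix at `t` and both start
with the same symbol, then the suffix at `s + 1` is smaller than the suffix at `t + 1`. (Nothing
is required if one of the latter is empty. This cannot happen if the last symbol of `T` occurs
only once.) -/
def IsExtensible {α : Type*} (T : List α) (prec : Fin T.length → Fin T.length → Prop) : Prop :=
  ∀ (s t : ℕ) (hs : s + 1 < T.length) (ht : t + 1 < T.length),
    prec ⟨s, by omega⟩ ⟨t, by omega⟩ → T[s] = T[t] → prec ⟨s + 1, hs⟩ ⟨t + 1, ht⟩

/-! ### Straight-line programs -/

/-- The right-hand side of a rule that may use the nonterminals `0, …, k - 1`: a terminal, a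
concatenation of two nonterminals, or a run of `t > 0` copies of a nonterminal. -/
inductive Rule (α : Type*) (k : ℕ) where
  | terminal (a : α) : Rule α k
  | concat (B C : Fin k) : Rule α k
  | run (B : Fin k) (t : ℕ) (ht : 0 < t) : Rule α k

/-- A run-length straight-line program: a nonempty sequence of rules, one for each nonterminal
`0, …, size - 1`, where the right-hand side of rule `i` uses only nonterminals smaller than `i`.
The initial symbol is the last nonterminal. (Nonterminals that are not reachable from the initial
symbol are tolerated; removing them only makes the program smaller.) -/
structure RLSLP (α : Type*) where
  size : ℕ
  size_pos : 0 < size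
  rule : (i : Fin size) → Rule α i

/-- The string generated by a nonterminal. -/
def RLSLP.expansion {α : Type*} (G : RLSLP α) (i : Fin G.size) : List α :=
  match G.rule i with
  | .terminal a => [a]
  | .concat B C => G.expansion ⟨B, B.2.trans i.2⟩ ++ G.expansion ⟨C, C.2.trans i.2⟩
  | .run B t _ => (List.replicate t (G.expansion ⟨B, B.2.trans i.2⟩)).flatten
termination_by (i : ℕ)
decreasing_by all_goals exact Fin.is_lt _

/-- `G` generates the text `T`. -/
def RLSLP.Generates {α : Type*} (G : RLSLP α) (T : List α) : Prop :=
  G.expansion ⟨G.size - 1, Nat.sub_lt G.size_pos Nat.one_pos⟩ = T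

/-- `G` is a straight-line program: it has no run-length rule. -/
def RLSLP.IsSLP {α : Type*} (G : RLSLP α) : Prop :=
  ∀ (i : Fin G.size) (B : Fin i) (t : ℕ) (ht : 0 < t), G.rule i ≠ .run B t ht

/-- `g`: the least number of rules of a straight-line program that generates `T`. -/
noncomputable def slpSize {α : Type*} (T : List α) : ℕ :=
  sInf {k | ∃ G : RLSLP α, G.IsSLP ∧ G.Generates T ∧ G.size = k}

/-- `g_rl`: the least number of rules of a run-length straight-line program that
generates `T`. -/
noncomputable def rlslpSize {α : Type*} (T : List α) : ℕ :=
  sInf {k | ∃ G : RLSLP α, G.Generates T ∧ G.size = k}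

end TextParse

open TextParse

/-! For the grammar bounds, choose for each nonterminal the node of the parse tree that starts the
least suffix. Expand only these nodes; every other node becomes one phrase copied from the chosen
node with its label. Extensibility carries the comparison of the two starts to all later positions
of the copy, so the phrase is ordered. Expanding a concatenation adds one phrase. A run of copies of
`B` becomes one expanded copy plus one phrase copied at distance `|B|`, leftwards or rightwards
according to which of the two suffixes is smaller. Hence each nonterminal adds at most one phrase to
the initial one (`RLSLP.exists_phrases_of_node`). Without runs, every copy joins two distinct nodes
with the same label, and these are disjoint.

The bound in `b` does not pass through grammars. The greedy parse, which always takes the longest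
match with a smaller suffix, is ordered, so it suffices to bound its length. Consider its phrases of
length in `[d, 2d)`. A window of length `3d` that starts fewer than `d` positions before such a
phrase contains the phrase and the next symbol. It must be the least window with its content, since
a smaller one would yield a longer match (`IsMaximalMatch.not_suffixLT_of_window_eq`). So these
windows, `d` for each phrase except possibly one near the beginning, have distinct contents.
Following sources, which is acyclic, brings every window to the end of some phrase of the
bidirectional scheme, so there are at most `3db` contents
(`IsBidirectionalScheme.exists_window_representatives`). Each dyadic class of lengths thus has at
most `3b + 1` phrases. About `log (n / b)` classes matter, because at most `b` phrases have length
`n / b` or more. -/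

namespace TextParse

variable {α : Type*}

/-! ### Tilings -/

theorem Tiles.append {P Q : List Phrase} {p q n : ℕ} (hP : Tiles p q P) (hQ : Tiles q n Q) :
    Tiles p n (P ++ Q) := by
  induction P generalizing p with
  | nil => cases hP; exact hQ
  | cons B P ih => exact ⟨hP.1, ih hP.2⟩

theorem tiles_singleton (B : Phrase) : Tiles B.start (B.start + B.len) [B] := ⟨rfl, rfl⟩

theorem Tiles.le {P : List Phrase} {p n : ℕ} (h : Tiles p n P) : p ≤ n := by
  induction P generalizing p with
  | nil => exact le_of_eq h
  | cons B P ih => have := ih h.2; omega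

theorem Tiles.bounds {P : List Phrase} {p n : ℕ} (h : Tiles p n P) :
    ∀ B ∈ P, p ≤ B.start ∧ B.start + B.len ≤ n := by
  induction P generalizing p with
  | nil => simp
  | cons C P ih =>
    intro B hB
    have h1 := h.1
    have h2 := h.2.le
    rcases List.mem_cons.1 hB with rfl | hB
    · omega
    · have := ih h.2 B hB
      omega

/-- Every position of a tiled interval lies in one of the phrases. -/
theorem Tiles.exists_mem {P : List Phrase} {p n i : ℕ} (h : Tiles p n P) (hp : p ≤ i)
    (hi : i < n) : ∃ B ∈ P, B.start ≤ i ∧ i < B.start + B.len := by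
  induction P generalizing p with
  | nil => have : p = n := h; omega
  | cons C P ih =>
    have h1 := h.1
    by_cases hc : i < p + C.len
    · exact ⟨C, by simp, by omega, by omega⟩
    · obtain ⟨B, hB, h'⟩ := ih h.2 (by omega)
      exact ⟨B, by simp [hB], h'⟩

/-- The intervals covered by the nonempty phrases of a tiling, as a finite set of pairs
(start, length). -/
theorem Tiles.exists_finset {P : List Phrase} {p n : ℕ} (h : Tiles p n P)
    (hpos : ∀ B ∈ P, 1 ≤ B.len) :
    ∃ A : Finset (ℕ × ℕ), A.card = P.length ∧
      (∀ x ∈ A, ∃ B ∈ P, x = (B.start, B.len)) ∧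
      ∀ x ∈ A, ∀ y ∈ A, x ≠ y → x.1 + x.2 ≤ y.1 ∨ y.1 + y.2 ≤ x.1 := by
  classical
  induction P generalizing p with
  | nil => exact ⟨∅, by simp⟩
  | cons B P ih =>
    obtain ⟨A, hcard, hmem, hdisj⟩ := ih h.2 fun C hC => hpos C (by simp [hC])
    have h1 := h.1
    have hpB := hpos B (by simp)
    have hge : ∀ x ∈ A, B.start + B.len ≤ x.1 := by
      intro x hx
      obtain ⟨C, hC, rfl⟩ := hmem x hx
      have := (h.2.bounds C hC).1
      simp only
      omega
    have hnot : (B.start, B.len) ∉ A := fun hx => by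
      have := hge _ hx
      simp only at this
      omega
    refine ⟨insert (B.start, B.len) A, by simp [Finset.card_insert_of_notMem hnot, hcard], ?_, ?_⟩
    · intro x hx
      rcases Finset.mem_insert.1 hx with rfl | hx
      · exact ⟨B, by simp, rfl⟩
      · obtain ⟨C, hC, rfl⟩ := hmem x hx
        exact ⟨C, by simp [hC], rfl⟩
    · intro x hx y hy hxy
      rcases Finset.mem_insert.1 hx with rfl | hx <;> rcases Finset.mem_insert.1 hy with rfl | hy
      · exact absurd rfl hxy
      · exact Or.inl (hge y hy)
      · exact Or.inr (hge x hx)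
      · exact hdisj x hx y hy hxy

theorem Phrase.IsValid.one_le_len {T : List α} {B : Phrase} (h : B.IsValid T) : 1 ≤ B.len := by
  unfold Phrase.IsValid at h
  split at h
  · exact h.ge
  · exact h.1

/-! ### Ordered phrases -/

/-- The suffix starting at `q` is strictly smaller than the suffix starting at `p`. -/
def SuffixLT {n : ℕ} (prec : Fin n → Fin n → Prop) (q p : ℕ) : Prop :=
  ∃ (hq : q < n) (hp : p < n), prec ⟨q, hq⟩ ⟨p, hp⟩

/-- Every position of a copied phrase is copied from the start of a smaller suffix. -/
def Phrase.IsOrdered {n : ℕ} (prec : Fin n → Fin n → Prop) (B : Phrase) : Prop :=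
  ∀ s, B.source = some s → ∀ j < B.len, SuffixLT prec (s + j) (B.start + j)

theorem isOrderedParse_of_forall {T : List α} {prec : Fin T.length → Fin T.length → Prop}
    {P : List Phrase} (ht : Tiles 0 T.length P) (hv : ∀ B ∈ P, B.IsValid T)
    (ho : ∀ B ∈ P, B.IsOrdered prec) : IsOrderedParse T prec P := by
  refine ⟨⟨ht, hv⟩, ?_⟩
  rintro p q ⟨B, hB, s, hs, j, hj, hp, hq⟩
  obtain ⟨h1, h2, h⟩ := ho B hB s hs j hj
  have e1 : q = ⟨s + j, h1⟩ := Fin.ext hq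
  have e2 : p = ⟨B.start + j, h2⟩ := Fin.ext hp
  rw [e1, e2]
  exact h

/-- Extensibility carries the comparison of two suffixes along a common prefix. -/
theorem SuffixLT.add {T : List α} {prec : Fin T.length → Fin T.length → Prop}
    (hext : IsExtensible T prec) {q p : ℕ} (h : SuffixLT prec q p) {d : ℕ}
    (hq : q + d < T.length) (hp : p + d < T.length)
    (heq : ∀ j < d, T[q + j]? = T[p + j]?) : SuffixLT prec (q + d) (p + d) := by
  induction d with
  | zero => exact h
  | succ d ih =>
    obtain ⟨h1, h2, h3⟩ := ih (by omega) (by omega) fun j hj => heq j (by omega)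
    have e := heq d (by omega)
    rw [List.getElem?_eq_getElem h1, List.getElem?_eq_getElem h2] at e
    exact ⟨hq, hp, hext (q + d) (p + d) hq hp h3 (by simpa using e)⟩

theorem SuffixLT.ne {n : ℕ} {prec : Fin n → Fin n → Prop} [Std.Irrefl prec] {q p : ℕ}
    (h : SuffixLT prec q p) : q ≠ p := by
  rintro rfl
  obtain ⟨h1, _, h3⟩ := h
  exact irrefl _ h3

theorem SuffixLT.trichotomy {n : ℕ} {prec : Fin n → Fin n → Prop}
    [IsStrictTotalOrder (Fin n) prec] {q p : ℕ} (hq : q < n) (hp : p < n) :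
    SuffixLT prec q p ∨ q = p ∨ SuffixLT prec p q := by
  rcases trichotomous_of prec ⟨q, hq⟩ ⟨p, hp⟩ with h | h | h
  · exact Or.inl ⟨hq, hp, h⟩
  · exact Or.inr (Or.inl (by simpa using h))
  · exact Or.inr (Or.inr ⟨hp, hq, h⟩)

/-- A copy of a substring that starts a smaller suffix is a valid ordered phrase. -/
theorem copy_isValid_isOrdered {T : List α} {prec : Fin T.length → Fin T.length → Prop}
    [IsStrictTotalOrder (Fin T.length) prec] (hext : IsExtensible T prec) {s t l : ℕ}
    (h : SuffixLT prec s t) (hl : 1 ≤ l) (hs : s + l ≤ T.length) (ht : t + l ≤ T.length)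
    (heq : ∀ j < l, T[s + j]? = T[t + j]?) :
    Phrase.IsValid T ⟨t, l, some s⟩ ∧ Phrase.IsOrdered prec ⟨t, l, some s⟩ := by
  refine ⟨⟨hl, h.ne, hs, heq⟩, ?_⟩
  intro s' hs' j hj
  obtain rfl : s = s' := by simpa using hs'
  simp only at hj
  exact h.add hext (by omega) (show t + j < T.length by omega) fun i hi => heq i (by omega)

theorem explicit_isValid_isOrdered (T : List α) (prec : Fin T.length → Fin T.length → Prop)
    (t : ℕ) : Phrase.IsValid T ⟨t, 1, none⟩ ∧ Phrase.IsOrdered prec ⟨t, 1, none⟩ :=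
  ⟨rfl, fun s hs => by simp at hs⟩

/-! ### Straight-line programs -/

/-- Deleting the first or the last copy of `w` leaves the same string. This periodicity lets all but
one copy in a run be a single phrase. -/
theorem flatten_replicate_getElem?_add_length (w : List α) (m : ℕ) {j : ℕ}
    (hj : j < m * w.length) :
    (List.replicate (m + 1) w).flatten[w.length + j]? =
      (List.replicate (m + 1) w).flatten[j]? := by
  conv_lhs => rw [List.replicate_succ, List.flatten_cons]
  conv_rhs => rw [List.replicate_succ', List.flatten_append]
  rw [List.getElem?_append_right (by omega), List.getElem?_append_left (by simpa using hj)]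
  simp

theorem flatten_replicate_getElem? (w : List α) {t r j : ℕ} (hr : r < t) (hj : j < w.length) :
    (List.replicate t w).flatten[r * w.length + j]? = w[j]? := by
  induction r generalizing t with
  | zero =>
    obtain ⟨m, rfl⟩ : ∃ m, t = m + 1 := ⟨t - 1, by omega⟩
    rw [List.replicate_succ, List.flatten_cons, List.getElem?_append_left (by omega)]
    simp
  | succ r ih =>
    obtain ⟨m, rfl⟩ : ∃ m, t = m + 1 := ⟨t - 1, by omega⟩
    rw [List.replicate_succ, List.flatten_cons, add_mul, one_mul,
      List.getElem?_append_right (by omega), ← ih (t := m) (by omega)]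
    congr 1
    omega

namespace RLSLP

variable {G : RLSLP α}

/-- The nonterminal of `G` that the rule of `i` refers to by `B`. -/
abbrev lift {i : Fin G.size} (B : Fin i) : Fin G.size := ⟨B, B.2.trans i.2⟩

theorem expansion_terminal {i : Fin G.size} {a : α} (h : G.rule i = .terminal a) :
    G.expansion i = [a] := by
  rw [expansion, h]

theorem expansion_concat {i : Fin G.size} {B C : Fin i} (h : G.rule i = .concat B C) :
    G.expansion i = G.expansion (lift B) ++ G.expansion (lift C) := by
  rw [expansion, h]

theorem expansion_run {i : Fin G.size} {B : Fin i} {t : ℕ} {ht : 0 < t}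
    (h : G.rule i = .run B t ht) :
    G.expansion i = (List.replicate t (G.expansion (lift B))).flatten := by
  rw [expansion, h]

theorem length_expansion_run {i : Fin G.size} {B : Fin i} {t : ℕ} {ht : 0 < t}
    (h : G.rule i = .run B t ht) :
    (G.expansion i).length = t * (G.expansion (lift B)).length := by
  simp [expansion_run h]

theorem one_le_length_expansion (i : Fin G.size) : 1 ≤ (G.expansion i).length := by
  induction i using WellFoundedLT.induction with
  | ind i ih =>
    rcases h : G.rule i with a | ⟨B, C⟩ | ⟨B, t, ht⟩
    · simp [expansion_terminal h]
    · have := ih (lift B) B.2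
      simp only [expansion_concat h, List.length_append]
      omega
    · rw [length_expansion_run h]
      exact Nat.mul_pos ht (ih (lift B) B.2)

/-! ### Nodes of the parse tree -/

/-- In the parse tree, a node labelled `i` has a child labelled `k` at the offset `d`. -/
inductive Child (G : RLSLP α) (i : Fin G.size) : Fin G.size → ℕ → Prop
  | left {B C : Fin i} (h : G.rule i = .concat B C) : Child G i (lift B) 0
  | right {B C : Fin i} (h : G.rule i = .concat B C) :
      Child G i (lift C) (G.expansion (lift B)).length
  | run {B : Fin i} {t : ℕ} {ht : 0 < t} (h : G.rule i = .run B t ht) {r : ℕ} (hr : r < t) :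
      Child G i (lift B) (r * (G.expansion (lift B)).length)

theorem Child.lt {i k : Fin G.size} {d : ℕ} (h : G.Child i k d) : k < i := by
  cases h with
  | @left B => exact B.2
  | @right _ C => exact C.2
  | @run B => exact B.2

theorem Child.add_le {i k : Fin G.size} {d : ℕ} (h : G.Child i k d) :
    d + (G.expansion k).length ≤ (G.expansion i).length := by
  cases h with
  | left h => simp [expansion_concat h]
  | right h => simp [expansion_concat h]
  | run h hr =>
    rw [length_expansion_run h, ← Nat.succ_mul]
    exact Nat.mul_le_mul_right _ hr

theorem Child.getElem? {i k : Fin G.size} {d j : ℕ} (h : G.Child i k d)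
    (hj : j < (G.expansion k).length) : (G.expansion i)[d + j]? = (G.expansion k)[j]? := by
  cases h with
  | left h => rw [expansion_concat h, List.getElem?_append_left (by omega)]; simp
  | right h => rw [expansion_concat h, List.getElem?_append_right (by omega)]; simp
  | run h hr => rw [expansion_run h, flatten_replicate_getElem? _ hr hj]

/-- Distinct children of a node are disjoint. -/
theorem Child.disjoint {i k k' : Fin G.size} {d d' : ℕ} (h : G.Child i k d)
    (h' : G.Child i k' d') : (k = k' ∧ d = d') ∨ d + (G.expansion k).length ≤ d' ∨
      d' + (G.expansion k').length ≤ d := by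
  cases h with
  | left h =>
    cases h' with
    | left h' => simp [h] at h'; simp [h']
    | right h' => simp [h] at h'; simp [h']
    | run h' hr => simp [h] at h'
  | right h =>
    cases h' with
    | left h' => simp [h] at h'; simp [h']
    | right h' => simp [h] at h'; simp [h']
    | run h' hr => simp [h] at h'
  | @run B t ht h r hr =>
    cases h' with
    | left h' => simp [h] at h'
    | right h' => simp [h] at h'
    | @run B' t' ht' h' r' hr' =>
      obtain ⟨rfl, rfl⟩ : B = B' ∧ t = t' := by simpa [h] using h'
      rcases lt_trichotomy r r' with hlt | rfl | hlt
      · right; left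
        rw [← Nat.succ_mul]
        exact Nat.mul_le_mul_right _ hlt
      · simp
      · right; right
        rw [← Nat.succ_mul]
        exact Nat.mul_le_mul_right _ hlt

/-- In the parse tree, a node labelled `i` has a (not necessarily proper) descendant labelled `k`
at the offset `d`. -/
inductive Desc (G : RLSLP α) : Fin G.size → Fin G.size → ℕ → Prop
  | refl (i : Fin G.size) : Desc G i i 0
  | head {i k l : Fin G.size} {d e : ℕ} (h : G.Child i k d) (h' : Desc G k l e) :
      Desc G i l (d + e)

/-- `Desc` grows at the top, which suits comparing two nodes from a common ancestor; the
construction of phrases descends and needs to grow paths at the bottom. -/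
theorem Desc.tail {i k l : Fin G.size} {d e : ℕ} (h : G.Desc i k d) (h' : G.Child k l e) :
    G.Desc i l (d + e) := by
  induction h with
  | refl i => simpa using Desc.head h' (.refl l)
  | head h1 _ ih => rw [add_assoc]; exact .head h1 (ih h')

theorem Desc.le {i k : Fin G.size} {d : ℕ} (h : G.Desc i k d) : k ≤ i := by
  induction h with
  | refl i => exact le_rfl
  | head h _ ih => exact ih.trans h.lt.le

theorem Desc.add_le {i k : Fin G.size} {d : ℕ} (h : G.Desc i k d) :
    d + (G.expansion k).length ≤ (G.expansion i).length := by
  induction h with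
  | refl i => simp
  | head h _ ih => have := h.add_le; omega

theorem Desc.getElem? {i k : Fin G.size} {d j : ℕ} (h : G.Desc i k d)
    (hj : j < (G.expansion k).length) : (G.expansion i)[d + j]? = (G.expansion k)[j]? := by
  induction h with
  | refl i => simp
  | head h h' ih =>
    have := h'.add_le
    rw [← ih hj, ← h.getElem? (by omega), add_assoc]

/-- Distinct nodes with the same label are disjoint. -/
theorem Desc.disjoint {i k : Fin G.size} {d d' : ℕ} (h : G.Desc i k d) (h' : G.Desc i k d') :
    d = d' ∨ d + (G.expansion k).length ≤ d' ∨ d' + (G.expansion k).length ≤ d := by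
  induction h generalizing d' with
  | refl i =>
    cases h' with
    | refl => exact Or.inl rfl
    -- Labels strictly decrease down the tree, so no node lies properly below another with its
    -- label.
    | head h1 h2 => exact absurd h1.lt (not_lt.2 h2.le)
  | head h1 h2 ih =>
    cases h' with
    | refl => exact absurd h1.lt (not_lt.2 h2.le)
    | head h1' h2' =>
      have := h2.add_le
      have := h2'.add_le
      rcases h1.disjoint h1' with ⟨rfl, rfl⟩ | h | h
      · have := ih h2'
        omega
      · omega
      · omega

/-! ### From grammars to ordered parses -/

/-- If `G` generates `T`, then its nonterminals can be expanded at their least nodes in the parse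
tree only, all other nodes being copied. For the node labelled `i` at position `p`, this yields
phrases that cover it, whose number exceeds by at most one the number of nonterminals `k` that are
expanded; their least nodes `m k` lie inside the given node. -/
theorem exists_phrases_of_node {T : List α} {prec : Fin T.length → Fin T.length → Prop}
    [IsStrictTotalOrder (Fin T.length) prec] (hext : IsExtensible T prec) {root : Fin G.size}
    (hG : G.expansion root = T) {m : Fin G.size → ℕ}
    (hm : ∀ k q, G.Desc root k q → G.Desc root k (m k) ∧ (m k = q ∨ SuffixLT prec (m k) q))
    (i : Fin G.size) : ∀ p, G.Desc root i p →
    ∃ (Q : List Phrase) (S : Finset (Fin G.size)),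
      Tiles p (p + (G.expansion i).length) Q ∧
      (∀ B ∈ Q, B.IsValid T ∧ B.IsOrdered prec) ∧
      (G.IsSLP → NonOverlapping Q) ∧
      Q.length ≤ S.card + 1 ∧
      ∀ k ∈ S, k ≤ i ∧ p ≤ m k ∧ m k < p + (G.expansion i).length := by
  induction i using WellFoundedLT.induction with
  | ind i ih =>
  intro p hp
  have hnode : ∀ {k q}, G.Desc root k q → q + (G.expansion k).length ≤ T.length ∧
      ∀ j < (G.expansion k).length, T[q + j]? = (G.expansion k)[j]? := fun {k q} h => by
    subst hG
    exact ⟨h.add_le, fun j hj => h.getElem? hj⟩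
  have hi := one_le_length_expansion i
  obtain ⟨hpn, hpe⟩ := hnode hp
  obtain ⟨hd, hmin⟩ := hm i p hp
  rcases hmin with hmin | hmin
  swap
  -- Not the least node of its label: one copied phrase, charged to no nonterminal.
  · obtain ⟨hdn, hde⟩ := hnode hd
    obtain ⟨hv, ho⟩ := copy_isValid_isOrdered hext hmin hi hdn hpn
      fun j hj => (hde j hj).trans (hpe j hj).symm
    refine ⟨[⟨p, _, some (m i)⟩], ∅, tiles_singleton _, by simpa using ⟨hv, ho⟩, ?_, by simp,
      by simp⟩
    intro _ B hB s hs
    obtain rfl := List.mem_singleton.1 hB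
    obtain rfl : m i = s := by simpa using hs
    have := hmin.ne
    have := hp.disjoint hd
    simp only
    omega
  rcases h : G.rule i with a | ⟨B, C⟩ | ⟨B, t, ht⟩
  · refine ⟨[⟨p, 1, none⟩], ∅, ?_, ?_, ?_, by simp, by simp⟩
    · rw [expansion_terminal h]
      exact tiles_singleton ⟨p, 1, none⟩
    · simpa using explicit_isValid_isOrdered T prec p
    · intro _ B hB s hs
      obtain rfl := List.mem_singleton.1 hB
      simp at hs
  · have hlen : (G.expansion i).length =
        (G.expansion (lift B)).length + (G.expansion (lift C)).length := by
      simp [expansion_concat h]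
    obtain ⟨Q, S, hQ1, hQ2, hQ3, hQ4, hQ5⟩ := ih (lift B) B.2 _ (hp.tail (.left h))
    obtain ⟨R, S', hR1, hR2, hR3, hR4, hR5⟩ := ih (lift C) C.2 _ (hp.tail (.right h))
    rw [add_zero] at hQ1 hQ5
    -- A charged `k` has `m k` inside the child that charged it, and the two children are disjoint.
    have hdisj : Disjoint S S' := Finset.disjoint_left.2 fun k hk hk' => by
      have := hQ5 k hk
      have := hR5 k hk'
      omega
    have hnot : i ∉ S ∪ S' := fun hk => by
      rcases Finset.mem_union.1 hk with hk | hk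
      · exact absurd (hQ5 i hk).1 (not_le.2 (Fin.lt_def.2 B.2))
      · exact absurd (hR5 i hk).1 (not_le.2 (Fin.lt_def.2 C.2))
    refine ⟨Q ++ R, insert i (S ∪ S'), ?_, ?_, ?_, ?_, ?_⟩
    · rw [hlen, ← add_assoc]
      exact hQ1.append hR1
    · intro D hD
      exact (List.mem_append.1 hD).elim (hQ2 D) (hR2 D)
    · intro hs D hD
      exact (List.mem_append.1 hD).elim (hQ3 hs D) (hR3 hs D)
    · rw [Finset.card_insert_of_notMem hnot, Finset.card_union_of_disjoint hdisj,
        List.length_append]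
      omega
    · intro k hk
      rcases Finset.mem_insert.1 hk with rfl | hk
      · exact ⟨le_rfl, by omega, by omega⟩
      · rcases Finset.mem_union.1 hk with hk | hk
        · have := hQ5 k hk
          exact ⟨this.1.trans (Fin.le_def.2 B.2.le), by omega, by omega⟩
        · have := hR5 k hk
          exact ⟨this.1.trans (Fin.le_def.2 C.2.le), by omega, by omega⟩
  · have hB := one_le_length_expansion (lift B)
    have hlen := length_expansion_run h
    have hslp : ¬ G.IsSLP := fun hs => hs i B t ht h
    obtain ⟨r, rfl⟩ : ∃ r, t = r + 1 := ⟨t - 1, by omega⟩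
    set w := (G.expansion (lift B)).length with hw
    have hlen' : (G.expansion i).length = r * w + w := by rw [hlen, Nat.succ_mul]
    -- Only the first or the last copy of `B` is expanded; charging `i` pays for the one phrase that
    -- copies the rest.
    have key : ∀ q, G.Desc root (lift B) q → (q = p ∨ q = p + r * w) →
        ∃ S : Finset (Fin G.size), ∃ Q : List Phrase, Tiles q (q + w) Q ∧
        (∀ B ∈ Q, B.IsValid T ∧ B.IsOrdered prec) ∧ Q.length + 1 ≤ S.card + 1 ∧
        ∀ k ∈ S, k ≤ i ∧ p ≤ m k ∧ m k < p + (G.expansion i).length := by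
      intro q hq hqp
      obtain ⟨Q, S, hQ1, hQ2, hQ3, hQ4, hQ5⟩ := ih (lift B) B.2 _ hq
      have hnot : i ∉ S := fun hk => absurd (hQ5 i hk).1 (not_le.2 (Fin.lt_def.2 B.2))
      refine ⟨insert i S, Q, hQ1, hQ2, by rw [Finset.card_insert_of_notMem hnot]; omega, ?_⟩
      intro k hk
      rcases Finset.mem_insert.1 hk with rfl | hk
      · exact ⟨le_rfl, by omega, by omega⟩
      · have := hQ5 k hk
        exact ⟨this.1.trans (Fin.le_def.2 B.2.le), by omega, by omega⟩
    have hfirst : G.Desc root (lift B) p := by simpa using hp.tail (.run h (r := 0) (by omega))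
    have hlast : G.Desc root (lift B) (p + r * w) := hp.tail (.run h (r := r) (by omega))
    -- With a single copy of `B` the remaining phrase would be empty, so it is omitted.
    rcases Nat.eq_zero_or_pos r with rfl | hr
    · obtain ⟨S, Q, hQ1, hQ2, hQ3, hQ4⟩ := key p hfirst (Or.inl rfl)
      refine ⟨Q, S, ?_, hQ2, fun hs => absurd hs hslp, by omega, hQ4⟩
      simpa [hlen'] using hQ1
    have hrw : 1 ≤ r * w := Nat.mul_pos hr hB
    have hper : ∀ j < r * w, T[p + w + j]? = T[p + j]? := fun j hj => by
      rw [add_assoc, hpe _ (by omega), hpe _ (by omega), expansion_run h,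
        flatten_replicate_getElem?_add_length _ _ hj]
    -- The order decides whether the run is copied from its beginning or towards its end.
    rcases SuffixLT.trichotomy (prec := prec) (q := p) (p := p + w) (by omega) (by omega)
      with hlt | heq | hlt
    · obtain ⟨S, Q, hQ1, hQ2, hQ3, hQ4⟩ := key p hfirst (Or.inl rfl)
      have hvo := copy_isValid_isOrdered hext hlt hrw (by omega) (by omega)
        fun j hj => (hper j hj).symm
      refine ⟨Q ++ [⟨p + w, r * w, some p⟩], S, ?_, ?_, fun hs => absurd hs hslp, by simpa using hQ3,
        hQ4⟩
      · rw [hlen', add_comm (r * w), ← add_assoc]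
        exact hQ1.append (tiles_singleton ⟨p + w, r * w, some p⟩)
      · intro D hD
        rcases List.mem_append.1 hD with hD | hD
        · exact hQ2 D hD
        · rw [List.mem_singleton.1 hD]; exact hvo
    · omega
    · obtain ⟨S, Q, hQ1, hQ2, hQ3, hQ4⟩ := key _ hlast (Or.inr rfl)
      have hvo := copy_isValid_isOrdered hext hlt hrw (by omega) (by omega) hper
      refine ⟨⟨p, r * w, some (p + w)⟩ :: Q, S, ?_, ?_, fun hs => absurd hs hslp,
        by simpa using hQ3, hQ4⟩
      · rw [hlen', ← add_assoc]
        exact ⟨rfl, hQ1⟩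
      · intro D hD
        rcases List.mem_cons.1 hD with hD | hD
        · rw [hD]; exact hvo
        · exact hQ2 D hD

/-- A nonempty set of suffixes has a least one. -/
theorem exists_least_suffix {n : ℕ} (prec : Fin n → Fin n → Prop)
    [IsStrictTotalOrder (Fin n) prec] {s : Set ℕ} (hs : ∀ q ∈ s, q < n) (hne : s.Nonempty) :
    ∃ p ∈ s, ∀ q ∈ s, p = q ∨ SuffixLT prec p q := by
  obtain ⟨q₀, hq₀⟩ := hne
  have hwf : WellFounded prec := Finite.wellFounded_of_trans_of_irrefl prec
  obtain ⟨p, hp, hmin⟩ := hwf.has_min {x : Fin n | (x : ℕ) ∈ s} ⟨⟨q₀, hs q₀ hq₀⟩, hq₀⟩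
  refine ⟨p, hp, fun q hq => ?_⟩
  rcases SuffixLT.trichotomy (prec := prec) p.2 (hs q hq) with h | h | h
  · exact Or.inr h
  · exact Or.inl h
  · obtain ⟨h1, h2, h3⟩ := h
    exact absurd h3 (hmin ⟨q, h1⟩ hq)

/-- A program with `G.size` rules that generates `T` yields an ordered parse of at most
`G.size + 1` phrases, which is non-overlapping if there are no run-length rules. -/
theorem Generates.exists_isOrderedParse {T : List α} (hG : G.Generates T)
    {prec : Fin T.length → Fin T.length → Prop}
    [IsStrictTotalOrder (Fin T.length) prec] (hext : IsExtensible T prec) :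
    ∃ P, IsOrderedParse T prec P ∧ (G.IsSLP → NonOverlapping P) ∧ P.length ≤ G.size + 1 := by
  unfold Generates at hG
  set root : Fin G.size := ⟨G.size - 1, Nat.sub_lt G.size_pos Nat.one_pos⟩
  have hleast : ∀ k, ∃ p, ∀ q, G.Desc root k q → G.Desc root k p ∧ (p = q ∨ SuffixLT prec p q) := by
    intro k
    by_cases hk : ∃ q, G.Desc root k q
    · obtain ⟨p, hp, hmin⟩ := exists_least_suffix prec (s := {q | G.Desc root k q}) (fun q hq => by
        have h1 := Desc.add_le hq
        have h2 := one_le_length_expansion k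
        rw [hG] at h1
        omega) hk
      exact ⟨p, fun q hq => ⟨hp, hmin q hq⟩⟩
    -- A nonterminal absent from the parse tree gets an arbitrary value.
    · exact ⟨0, fun q hq => absurd ⟨q, hq⟩ hk⟩
  choose m hm using hleast
  obtain ⟨Q, S, h1, h2, h3, h4, -⟩ := exists_phrases_of_node hext hG hm root 0 (.refl root)
  rw [hG, zero_add] at h1
  refine ⟨Q, isOrderedParse_of_forall h1 (fun B hB => (h2 B hB).1) fun B hB => (h2 B hB).2, h3,
    h4.trans ?_⟩
  simpa using S.card_le_univ

/-! ### Existence of programs and schemes of minimum size -/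

/-- The straight-line program that appends the symbols of `T` one by one: the rule `2 * i`
generates the prefix of length `i + 1`, the rule `2 * i + 1` the symbol that follows it. -/
def ofList (T : List α) (hT : T ≠ []) : RLSLP α where
  size := 2 * T.length - 1
  size_pos := by have := List.length_pos_of_ne_nil hT; omega
  rule i :=
    if h : (i : ℕ) = 0 then .terminal (T[0]'(List.length_pos_of_ne_nil hT))
    else if h' : (i : ℕ) % 2 = 1 then .terminal (T[((i : ℕ) + 1) / 2]'(by have := i.2; omega))
    else .concat ⟨i - 2, by omega⟩ ⟨i - 1, by omega⟩

theorem ofList_isSLP (T : List α) (hT : T ≠ []) : (ofList T hT).IsSLP := by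
  intro i B t ht
  simp only [ofList]
  split_ifs <;> simp

theorem ofList_expansion (T : List α) (hT : T ≠ []) (k : ℕ)
    (hk : 2 * k < (ofList T hT).size) : (ofList T hT).expansion ⟨2 * k, hk⟩ = T.take (k + 1) := by
  have hk' : 2 * k < 2 * T.length - 1 := hk
  induction k with
  | zero =>
    rw [expansion_terminal (a := T[0]'(List.length_pos_of_ne_nil hT)) (by simp [ofList])]
    rw [List.take_add_one]
    simp [List.getElem?_eq_getElem (List.length_pos_of_ne_nil hT)]
  | succ k ih =>
    rw [expansion_concat (B := ⟨2 * k, by simp only; omega⟩) (C := ⟨2 * k + 1, by simp only; omega⟩)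
      (by simp [ofList]; omega)]
    rw [expansion_terminal (i := lift ⟨2 * k + 1, _⟩) (a := T[k + 1]'(by omega))
      (by simp [ofList]; congr 1; omega)]
    rw [ih (by omega) (by omega), List.take_add_one (i := k + 1),
      List.getElem?_eq_getElem (by omega)]
    rfl

theorem ofList_generates (T : List α) (hT : T ≠ []) : (ofList T hT).Generates T := by
  have := List.length_pos_of_ne_nil hT
  have h : (⟨(ofList T hT).size - 1, Nat.sub_lt (ofList T hT).size_pos Nat.one_pos⟩ :
      Fin (ofList T hT).size) = ⟨2 * (T.length - 1), by simp only [ofList]; omega⟩ := by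
    refine Fin.ext ?_
    simp only [ofList]
    omega
  rw [Generates, h, ofList_expansion]
  exact List.take_of_length_le (by omega)

end RLSLP

/-- `ofList` makes the set of sizes nonempty, so its infimum is attained and is not the default
value `0`. -/
theorem exists_rlslp_size_eq {T : List α} (hT : T ≠ []) :
    ∃ G : RLSLP α, G.Generates T ∧ G.size = rlslpSize T :=
  Nat.sInf_mem (s := {k | ∃ G : RLSLP α, G.Generates T ∧ G.size = k})
    ⟨_, RLSLP.ofList T hT, RLSLP.ofList_generates T hT, rfl⟩

theorem exists_slp_size_eq {T : List α} (hT : T ≠ []) :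
    ∃ G : RLSLP α, G.IsSLP ∧ G.Generates T ∧ G.size = slpSize T :=
  Nat.sInf_mem (s := {k | ∃ G : RLSLP α, G.IsSLP ∧ G.Generates T ∧ G.size = k})
    ⟨_, RLSLP.ofList T hT, RLSLP.ofList_isSLP T hT, RLSLP.ofList_generates T hT, rfl⟩

/-! ### Bidirectional schemes -/

/-- A property of phrases that some phrase at every position has holds throughout some tiling. -/
theorem exists_tiles_of_forall {n : ℕ} {good : Phrase → Prop}
    (h : ∀ t < n, ∃ B : Phrase, B.start = t ∧ 1 ≤ B.len ∧ t + B.len ≤ n ∧ good B) (t : ℕ)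
    (ht : t ≤ n) : ∃ P, Tiles t n P ∧ ∀ B ∈ P, good B := by
  induction hd : n - t using Nat.strong_induction_on generalizing t with
  | _ d ih =>
    rcases ht.eq_or_lt with rfl | hlt
    · exact ⟨[], rfl, by simp⟩
    · obtain ⟨B, hB1, hB2, hB3, hB4⟩ := h t hlt
      obtain ⟨P, hP1, hP2⟩ := ih (n - (t + B.len)) (by omega) (t + B.len) hB3 rfl
      exact ⟨B :: P, ⟨hB1, hP1⟩, by simpa using ⟨hB4, hP2⟩⟩

/-- The parse into explicit symbols copies nothing, so it is acyclic and the infimum is attained. -/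
theorem exists_isBidirectionalScheme_length_eq (T : List α) :
    ∃ P, IsBidirectionalScheme T P ∧ P.length = bidirectionalSize T := by
  refine Nat.sInf_mem (s := {k | ∃ P : List Phrase, IsBidirectionalScheme T P ∧ P.length = k}) ?_
  obtain ⟨P, h1, h2⟩ := exists_tiles_of_forall (n := T.length)
    (good := fun B => B.IsValid T ∧ B.source = none)
    (fun t ht => ⟨⟨t, 1, none⟩, rfl, le_rfl, ht, rfl, rfl⟩) 0 (Nat.zero_le _)
  refine ⟨_, P, ⟨⟨h1, fun B hB => (h2 B hB).1⟩, fun p hp => ?_⟩, rfl⟩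
  obtain ⟨q, ⟨B, hB, s, hs, -⟩, -⟩ := Relation.TransGen.head'_iff.1 hp
  simp [(h2 B hB).2] at hs

/-- A text with a bidirectional scheme of `b` phrases has at most `b * m` distinct substrings of
length `m`, where substrings that run past the end of the text are admitted. -/
theorem IsBidirectionalScheme.exists_window_representatives {T : List α} {P : List Phrase}
    (h : IsBidirectionalScheme T P) {m : ℕ} (hm : 1 ≤ m) :
    ∃ R : Finset ℕ, R.card ≤ P.length * m ∧
      ∀ i < T.length, ∃ r ∈ R, ∀ j < m, T[r + j]? = T[i + j]? := by
  obtain ⟨⟨htiles, hvalid⟩, hacyc⟩ := h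
  classical
  -- The representatives start among the last `m` positions of a phrase.
  refine ⟨P.toFinset.biUnion fun B => Finset.Ico (B.start + B.len - m) (B.start + B.len), ?_, ?_⟩
  · refine (Finset.card_biUnion_le_card_mul _ _ m fun B _ => ?_).trans
      (Nat.mul_le_mul_right _ P.toFinset_card_le)
    rw [Nat.card_Ico]
    omega
  let src : Fin T.length → Fin T.length → Prop := fun q p => Relation.TransGen (CopiedFrom P) p q
  have : IsTrans _ src := ⟨fun _ _ _ h1 h2 => h2.trans h1⟩
  have : Std.Irrefl src := ⟨fun p => hacyc p⟩
  have hwf : WellFounded src := Finite.wellFounded_of_trans_of_irrefl src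
  suffices H : ∀ x : Fin T.length, ∃ r ∈ P.toFinset.biUnion fun B =>
      Finset.Ico (B.start + B.len - m) (B.start + B.len), ∀ j < m, T[r + j]? = T[x + j]? from
    fun i hi => H ⟨i, hi⟩
  intro x
  induction x using hwf.induction with
  | _ x ih =>
    obtain ⟨B, hB, h1, h2⟩ := htiles.exists_mem (Nat.zero_le x) x.2
    by_cases hend : B.start + B.len < x + m
    · exact ⟨x, Finset.mem_biUnion.2 ⟨B, by simpa using hB, Finset.mem_Ico.2 ⟨by omega, h2⟩⟩,
        fun _ _ => rfl⟩
    have hv := hvalid B hB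
    unfold Phrase.IsValid at hv
    split at hv
    · exact ⟨x, Finset.mem_biUnion.2 ⟨B, by simpa using hB, Finset.mem_Ico.2 ⟨by omega, h2⟩⟩,
        fun _ _ => rfl⟩
    · rename_i s hs
      obtain ⟨-, -, hsn, heq⟩ := hv
      -- The window lies inside a copied phrase, so it has the same content at its source, where
      -- induction applies.
      obtain ⟨r, hr, hr'⟩ := ih ⟨s + (x - B.start), by omega⟩
        (Relation.TransGen.single ⟨B, hB, s, hs, x - B.start, by omega, by omega, rfl⟩)
      refine ⟨r, hr, fun j hj => (hr' j hj).trans ?_⟩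
      have := heq (x - B.start + j) (by omega)
      rw [← add_assoc, ← add_assoc, Nat.add_sub_cancel' h1] at this
      exact this

/-! ### The greedy ordered parse -/

/-- No smaller suffix agrees with the suffix at `t` on its first `l + 1` symbols. -/
def IsMaximalMatch (T : List α) (prec : Fin T.length → Fin T.length → Prop) (t l : ℕ) : Prop :=
  ∀ q, SuffixLT prec q t → ∃ j ≤ l, T[q + j]? ≠ T[t + j]?

/-- Matching lengths are bounded, so there is a least failing length. The phrase is one shorter, or
an explicit symbol when that would be empty. -/
theorem exists_greedy_phrase {T : List α} {prec : Fin T.length → Fin T.length → Prop}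
    [IsStrictTotalOrder (Fin T.length) prec] (hext : IsExtensible T prec) {t : ℕ}
    (ht : t < T.length) : ∃ B : Phrase, B.start = t ∧ 1 ≤ B.len ∧ t + B.len ≤ T.length ∧
      B.IsValid T ∧ B.IsOrdered prec ∧ IsMaximalMatch T prec t B.len := by
  classical
  let match' : ℕ → Prop := fun l => ∃ q, SuffixLT prec q t ∧ ∀ j < l, T[q + j]? = T[t + j]?
  -- Two distinct suffixes cannot agree past the end: where the shorter one stops, the longer one
  -- still has a symbol.
  have hfit : ∀ l, 1 ≤ l → match' l → t + l ≤ T.length := by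
    rintro l hl ⟨q, hq, heq⟩
    by_contra hlt
    have hne := hq.ne
    have hqn := hq.1
    rcases lt_or_gt_of_ne hne with hlt' | hlt'
    · have := heq (T.length - t) (by omega)
      rw [List.getElem?_eq_getElem (by omega), List.getElem?_eq_none (by omega)] at this
      simp at this
    · have := heq (T.length - q) (by omega)
      rw [List.getElem?_eq_none (by omega), List.getElem?_eq_getElem (by omega)] at this
      simp at this
  have hex : ∃ l, ¬ match' l :=
    ⟨T.length + 1, fun h => by have := hfit _ (by omega) h; omega⟩
  have hmax : ∀ l, Nat.find hex ≤ l + 1 → IsMaximalMatch T prec t l := by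
    intro l hl q hq
    by_contra! hcon
    exact Nat.find_spec hex ⟨q, hq, fun j hj => hcon j (by omega)⟩
  by_cases hone : Nat.find hex ≤ 1
  · obtain ⟨hv, ho⟩ := explicit_isValid_isOrdered T prec t
    exact ⟨⟨t, 1, none⟩, rfl, le_rfl, ht, hv, ho, hmax 1 (by omega)⟩
  · obtain ⟨l, hl⟩ : ∃ l, Nat.find hex = l + 1 := ⟨Nat.find hex - 1, by omega⟩
    have hmatch : match' l := not_not.1 (Nat.find_min hex (m := l) (by omega))
    have htl := hfit l (by omega) hmatch
    obtain ⟨q, hq, heq⟩ := hmatch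
    have hql : q + l ≤ T.length := by
      have := heq (l - 1) (by omega)
      rw [List.getElem?_eq_getElem (i := t + (l - 1)) (by omega)] at this
      have := (List.getElem?_eq_some_iff.1 this).1
      omega
    obtain ⟨hv, ho⟩ := copy_isValid_isOrdered hext hq (by omega) hql htl heq
    exact ⟨⟨t, l, some q⟩, rfl, by simp only; omega, htl, hv, ho, hmax l hl.le⟩

theorem exists_greedy_parse {T : List α} {prec : Fin T.length → Fin T.length → Prop}
    [IsStrictTotalOrder (Fin T.length) prec] (hext : IsExtensible T prec) :
    ∃ P, IsOrderedParse T prec P ∧ ∀ B ∈ P, IsMaximalMatch T prec B.start B.len := by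
  obtain ⟨P, h1, h2⟩ := exists_tiles_of_forall (n := T.length)
    (good := fun B => B.IsValid T ∧ B.IsOrdered prec ∧ IsMaximalMatch T prec B.start B.len)
    (fun t ht => by
      obtain ⟨B, rfl, h⟩ := exists_greedy_phrase hext ht
      exact ⟨B, rfl, h⟩) 0 (Nat.zero_le _)
  exact ⟨P, isOrderedParse_of_forall h1 (fun B hB => (h2 B hB).1) fun B hB => (h2 B hB).2.1,
    fun B hB => (h2 B hB).2.2⟩

/-- A window that contains a maximal match together with the symbol that follows it is the least
one with its content. -/
theorem IsMaximalMatch.not_suffixLT_of_window_eq {T : List α}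
    {prec : Fin T.length → Fin T.length → Prop}
    (hext : IsExtensible T prec) {t l i i' m : ℕ} (h : IsMaximalMatch T prec t l)
    (ht : t < T.length) (hi : i ≤ t) (hm : t + l < i + m)
    (heq : ∀ j < m, T[i' + j]? = T[i + j]?) : ¬ SuffixLT prec i' i := by
  intro hlt
  have h1 := heq (t - i) (by omega)
  rw [Nat.add_sub_cancel' hi, List.getElem?_eq_getElem ht] at h1
  have h2 := (List.getElem?_eq_some_iff.1 h1).1
  -- Extensibility moves the comparison to `t`, where the rest of the window matches `l + 1`
  -- symbols.
  have h3 := hlt.add hext (d := t - i) h2 (by omega) fun j hj => heq j (by omega)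
  rw [Nat.add_sub_cancel' hi] at h3
  obtain ⟨j, hj, hne⟩ := h _ h3
  have := heq (t - i + j) (by omega)
  rw [← add_assoc, ← add_assoc, Nat.add_sub_cancel' hi] at this
  exact hne this

/-- Pairwise disjoint maximal matches whose lengths lie between `d` and `2 * d` are few. -/
theorem card_le_of_maximalMatch {T : List α} {prec : Fin T.length → Fin T.length → Prop}
    [IsStrictTotalOrder (Fin T.length) prec] (hext : IsExtensible T prec) {P : List Phrase}
    (hP : IsBidirectionalScheme T P) {d : ℕ} (hd : 1 ≤ d) (A : Finset (ℕ × ℕ))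
    (hA : ∀ x ∈ A, x.1 < T.length ∧ d ≤ x.2 ∧ x.2 < 2 * d ∧ IsMaximalMatch T prec x.1 x.2)
    (hdisj : ∀ x ∈ A, ∀ y ∈ A, x ≠ y → x.1 + x.2 ≤ y.1 ∨ y.1 + y.2 ≤ x.1) :
    A.card ≤ 3 * P.length + 1 := by
  classical
  -- Length `3 * d` suffices for fewer than `d` symbols before the match, fewer than `2 * d` inside
  -- it, and the one after it.
  obtain ⟨R, hR, hrep⟩ := hP.exists_window_representatives (m := 3 * d) (by omega)
  -- A match starting before `d` may lack `d` window starts; any later disjoint match starts at `d`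
  -- or beyond.
  have hsmall : (A.filter fun x => x.1 < d).card ≤ 1 := by
    refine Finset.card_le_one.2 fun x hx y hy => ?_
    rw [Finset.mem_filter] at hx hy
    by_contra hxy
    have := hdisj x hx.1 y hy.1 hxy
    have := hA x hx.1
    have := hA y hy.1
    omega
  set A' := {x ∈ A | ¬ x.1 < d} with hA'
  have hsum : {x ∈ A | x.1 < d}.card + A'.card = A.card := by
    convert Finset.card_filter_add_card_filter_not (s := A) (fun x => x.1 < d)
  set W := A'.biUnion fun x => Finset.Ioc (x.1 - d) x.1 with hW
  have hWcard : W.card = A'.card * d := by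
    rw [hW, Finset.card_biUnion, Finset.sum_const_nat]
    · intro x hx
      have := (Finset.mem_filter.1 hx).2
      rw [Nat.card_Ioc]
      omega
    · intro x hx y hy hxy
      have hx' := Finset.mem_filter.1 hx
      have hy' := Finset.mem_filter.1 hy
      have := hdisj x hx'.1 y hy'.1 hxy
      have := hA x hx'.1
      have := hA y hy'.1
      refine Finset.disjoint_left.2 fun i hi hi' => ?_
      rw [Finset.mem_Ioc] at hi hi'
      omega
  have hWmem : ∀ i ∈ W, i < T.length ∧
      ∀ i' < T.length, (∀ j < 3 * d, T[i' + j]? = T[i + j]?) → ¬ SuffixLT prec i' i := by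
    intro i hi
    obtain ⟨x, hx, hix⟩ := Finset.mem_biUnion.1 hi
    rw [Finset.mem_Ioc] at hix
    obtain ⟨h1, h2, h3, h4⟩ := hA x (Finset.mem_filter.1 hx).1
    exact ⟨by omega, fun i' _ heq =>
      h4.not_suffixLT_of_window_eq hext h1 hix.2 (by omega) heq⟩
  choose! f hf hf' using hrep
  -- Two of these windows with one representative have equal content and are both least, so they
  -- coincide.
  have hle : W.card ≤ R.card := by
    refine Finset.card_le_card_of_injOn f (fun i hi => hf i (hWmem i hi).1) ?_
    intro i hi i' hi' hii
    obtain ⟨h1, h2⟩ := hWmem i hi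
    obtain ⟨h1', h2'⟩ := hWmem i' hi'
    have heq : ∀ j < 3 * d, T[i + j]? = T[i' + j]? := fun j hj => by
      rw [← hf' i h1 j hj, ← hf' i' h1' j hj, hii]
    rcases SuffixLT.trichotomy (prec := prec) h1 h1' with h | h | h
    · exact absurd h (h2' i h1 heq)
    · exact h
    · exact absurd h (h2 i' h1' fun j hj => (heq j hj).symm)
  have hmul : A'.card * d ≤ 3 * P.length * d := by
    calc A'.card * d = W.card := hWcard.symm
      _ ≤ P.length * (3 * d) := hle.trans hR
      _ = 3 * P.length * d := by ring
  have hA'card := Nat.le_of_mul_le_mul_right hmul hd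
  omega

/-- Pairwise disjoint intervals of length at least `d` inside `0, …, n - 1` are few. -/
theorem card_mul_le_of_disjoint {n d : ℕ} (A : Finset (ℕ × ℕ))
    (hA : ∀ x ∈ A, x.1 + x.2 ≤ n ∧ d ≤ x.2)
    (hdisj : ∀ x ∈ A, ∀ y ∈ A, x ≠ y → x.1 + x.2 ≤ y.1 ∨ y.1 + y.2 ≤ x.1) :
    A.card * d ≤ n := by
  classical
  have hcard : (A.biUnion fun x => Finset.Ico x.1 (x.1 + d)).card = A.card * d := by
    rw [Finset.card_biUnion, Finset.sum_const_nat]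
    · intro x _
      simp
    · intro x hx y hy hxy
      have := hdisj x hx y hy hxy
      have := hA x hx
      have := hA y hy
      refine Finset.disjoint_left.2 fun i hi hi' => ?_
      rw [Finset.mem_Ico] at hi hi'
      omega
  rw [← hcard]
  refine (Finset.card_le_card (t := Finset.range n) fun i hi => ?_).trans (by simp)
  obtain ⟨x, hx, hix⟩ := Finset.mem_biUnion.1 hi
  have := hA x hx
  rw [Finset.mem_Ico] at hix
  rw [Finset.mem_range]
  omega

/-- The greedy ordered parse is small compared to any bidirectional scheme. -/
theorem exists_isOrderedParse_length_le {T : List α}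
    {prec : Fin T.length → Fin T.length → Prop} [IsStrictTotalOrder (Fin T.length) prec]
    (hext : IsExtensible T prec) {P : List Phrase} (hP : IsBidirectionalScheme T P) {K : ℕ}
    (hK : T.length ≤ P.length * 2 ^ K) :
    ∃ Q, IsOrderedParse T prec Q ∧ Q.length ≤ K * (3 * P.length + 1) + P.length := by
  classical
  obtain ⟨Q, hQ, hmax⟩ := exists_greedy_parse hext
  have htiles := hQ.1.1
  have hpos : ∀ B ∈ Q, 1 ≤ B.len := fun B hB => (hQ.1.2 B hB).one_le_len
  obtain ⟨A, hcard, hmem, hdisj⟩ := htiles.exists_finset hpos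
  have hA : ∀ x ∈ A, 1 ≤ x.2 ∧ x.1 + x.2 ≤ T.length ∧ IsMaximalMatch T prec x.1 x.2 := by
    intro x hx
    obtain ⟨B, hB, rfl⟩ := hmem x hx
    exact ⟨hpos B hB, (htiles.bounds B hB).2, hmax B hB⟩
  refine ⟨Q, hQ, ?_⟩
  have hclass : ∀ k, (A.filter fun x => Nat.log 2 x.2 = k).card ≤ 3 * P.length + 1 := by
    intro k
    refine card_le_of_maximalMatch hext hP (d := 2 ^ k) Nat.one_le_two_pow _ ?_ ?_
    · intro x hx
      obtain ⟨hxA, rfl⟩ := Finset.mem_filter.1 hx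
      obtain ⟨h1, h2, h3⟩ := hA x hxA
      refine ⟨by omega, Nat.pow_log_le_self 2 (by omega), ?_, h3⟩
      rw [← pow_succ']
      exact Nat.lt_pow_succ_log_self (by norm_num) _
    · exact fun x hx y hy => hdisj x (Finset.mem_filter.1 hx).1 y (Finset.mem_filter.1 hy).1
  have hlong : (A.filter fun x => ¬ Nat.log 2 x.2 < K).card ≤ P.length := by
    have h := card_mul_le_of_disjoint (n := T.length) (d := 2 ^ K)
      (A.filter fun x => ¬ Nat.log 2 x.2 < K) ?_
      fun x hx y hy => hdisj x (Finset.mem_filter.1 hx).1 y (Finset.mem_filter.1 hy).1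
    · exact Nat.le_of_mul_le_mul_right (h.trans hK) (by positivity)
    · intro x hx
      obtain ⟨hx, hlog⟩ := Finset.mem_filter.1 hx
      obtain ⟨h1, h2, -⟩ := hA x hx
      exact ⟨h2, Nat.pow_le_of_le_log (by omega) (not_lt.1 hlog)⟩
  have hshort : (A.filter fun x => Nat.log 2 x.2 < K).card ≤ K * (3 * P.length + 1) := by
    calc (A.filter fun x => Nat.log 2 x.2 < K).card
        ≤ ((Finset.range K).biUnion fun k => A.filter fun x => Nat.log 2 x.2 = k).card := by
          refine Finset.card_le_card fun x hx => ?_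
          obtain ⟨hx, hlog⟩ := Finset.mem_filter.1 hx
          exact Finset.mem_biUnion.2 ⟨_, Finset.mem_range.2 hlog, Finset.mem_filter.2 ⟨hx, rfl⟩⟩
      _ ≤ (Finset.range K).card * (3 * P.length + 1) :=
          Finset.card_biUnion_le_card_mul _ _ _ fun k _ => hclass k
      _ = K * (3 * P.length + 1) := by simp
  have := Finset.card_filter_add_card_filter_not (s := A) (fun x => Nat.log 2 x.2 < K)
  omega

/-! ### The three bounds -/

/-- Every ordered-optimal parse has `O(b log (n / b))` phrases. -/
theorem IsOrderedOptimal.length_le_bidirectionalSize {T : List α} (hT : T ≠ [])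
    {prec : Fin T.length → Fin T.length → Prop} [IsStrictTotalOrder (Fin T.length) prec]
    (hext : IsExtensible T prec) {P : List Phrase} (hP : IsOrderedOptimal T prec P) :
    (P.length : ℝ) ≤ 9 * ((bidirectionalSize T : ℝ) *
      max 1 (Real.logb 2 ((T.length : ℝ) / (bidirectionalSize T : ℝ)))) := by
  obtain ⟨S, hS, hb⟩ := exists_isBidirectionalScheme_length_eq T
  rw [← hb]
  have hn := List.length_pos_of_ne_nil hT
  have hbpos : 0 < S.length := by
    rcases S with _ | ⟨B, S⟩
    · have : 0 = T.length := hS.1.1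
      omega
    · simp
  have hb0 : (0 : ℝ) < S.length := by exact_mod_cast hbpos
  have hb1 : (1 : ℝ) ≤ S.length := by exact_mod_cast hbpos
  have hn0 : (0 : ℝ) < T.length := by exact_mod_cast hn
  set L := Real.logb 2 ((T.length : ℝ) / S.length) with hL
  set K := ⌈L⌉₊ with hK
  set M := max 1 L with hM
  have hM1 : 1 ≤ M := le_max_left _ _
  -- Rounding up costs less than `1`, which is at most `M`.
  have hKM : (K : ℝ) ≤ 2 * M := by
    rcases le_total L 0 with h | h
    · have : K = 0 := Nat.ceil_eq_zero.2 h
      rw [this]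
      simp only [Nat.cast_zero]
      linarith
    · have h1 := Nat.ceil_lt_add_one h
      have h2 : L ≤ M := le_max_right _ _
      linarith
  have hpow : T.length ≤ S.length * 2 ^ K := by
    have h1 : (T.length : ℝ) / S.length ≤ 2 ^ K := by
      have := (Real.logb_le_iff_le_rpow (b := 2) (by norm_num) (div_pos hn0 hb0)).1 (Nat.le_ceil L)
      rwa [Real.rpow_natCast] at this
    rw [div_le_iff₀ hb0, mul_comm] at h1
    exact_mod_cast h1
  obtain ⟨Q, hQ, hQlen⟩ := exists_isOrderedParse_length_le hext hS hpow
  have hlen : (P.length : ℝ) ≤ K * (3 * S.length + 1) + S.length := by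
    exact_mod_cast (hP.2 Q hQ).trans hQlen
  -- With `b ≥ 1`, `3b + 1 ≤ 4b`: the classes contribute `8bM` and the long phrases `bM`, whence the
  -- constant `9`.
  have h1 : (K : ℝ) * (3 * S.length + 1) ≤ 2 * M * (4 * S.length) :=
    mul_le_mul hKM (by linarith) (by positivity) (by linarith)
  have h2 : (S.length : ℝ) ≤ S.length * M := le_mul_of_one_le_right hb0.le hM1
  linarith

theorem IsOrderedOptimal.length_le_rlslpSize {T : List α} (hT : T ≠ [])
    {prec : Fin T.length → Fin T.length → Prop} [IsStrictTotalOrder (Fin T.length) prec]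
    (hext : IsExtensible T prec) {P : List Phrase} (hP : IsOrderedOptimal T prec P) :
    P.length ≤ rlslpSize T + 1 := by
  obtain ⟨G, hG, hsize⟩ := exists_rlslp_size_eq hT
  obtain ⟨Q, hQ, -, hlen⟩ := hG.exists_isOrderedParse hext
  exact hsize ▸ (hP.2 Q hQ).trans hlen

theorem IsOrderedOptimalNonOverlapping.length_le_slpSize {T : List α} (hT : T ≠ [])
    {prec : Fin T.length → Fin T.length → Prop} [IsStrictTotalOrder (Fin T.length) prec]
    (hext : IsExtensible T prec) {P : List Phrase}
    (hP : IsOrderedOptimalNonOverlapping T prec P) : P.length ≤ slpSize T + 1 := by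
  obtain ⟨G, hslp, hG, hsize⟩ := exists_slp_size_eq hT
  obtain ⟨Q, hQ, hover, hlen⟩ := hG.exists_isOrderedParse hext
  exact hsize ▸ (hP.2 Q hQ (hover hslp)).trans hlen

end TextParse

theorem theorem12 :
    -- sources may overlap targets: `u ≤ g_rl + 1`
    (∀ (α : Type*) (T : List α), T ≠ [] →
      ∀ prec : Fin T.length → Fin T.length → Prop,
        IsStrictTotalOrder (Fin T.length) prec → IsExtensible T prec →
        ∀ P : List Phrase, IsOrderedOptimal T prec P → P.length ≤ rlslpSize T + 1) ∧
    -- hence `u = O(b log (n / b))`, with a universal constant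
    (∃ c : ℝ, 0 < c ∧ ∀ (α : Type*) (T : List α), T ≠ [] →
      ∀ prec : Fin T.length → Fin T.length → Prop,
        IsStrictTotalOrder (Fin T.length) prec → IsExtensible T prec →
        ∀ P : List Phrase, IsOrderedOptimal T prec P →
          (P.length : ℝ) ≤ c * ((bidirectionalSize T : ℝ) *
            max 1 (Real.logb 2 ((T.length : ℝ) / (bidirectionalSize T : ℝ))))) ∧
    -- sources may not overlap targets: `u ≤ g + 1`
    (∀ (α : Type*) (T : List α), T ≠ [] →
      ∀ prec : Fin T.length → Fin T.length → Prop,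
        IsStrictTotalOrder (Fin T.length) prec → IsExtensible T prec →
        ∀ P : List Phrase, IsOrderedOptimalNonOverlapping T prec P →
          P.length ≤ slpSize T + 1) :=
  ⟨fun _ _ hT _ _ hext _ hP => hP.length_le_rlslpSize hT hext,
    ⟨9, by norm_num, fun _ _ hT _ _ hext _ hP => hP.length_le_bidirectionalSize hT hext⟩,
    fun _ _ hT _ _ hext _ hP => hP.length_le_slpSize hT hext⟩
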